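/- Let $\mathbb{T}=\{z\in\mathbb{C}:|z|=1\}$. A $\mathbb{T}$-gain $\varphi$ on a finite simple graph $G$ assigns to each oriented edge $\overrightarrow{e_{st}}$ of $G$ an element $\varphi(\overrightarrow{e_{st}})\in\mathbb{T}$ such that $\varphi(\overrightarrow{e_{ts}})=\varphi(\overrightarrow{e_{st}})^{-1}$. For $\Phi=(G,\varphi)$, the gain adjacency matrix $A(\Phi)$ has $(s,t)$ entry $\varphi(\overrightarrow{e_{st}})$ if $v_s$ and $v_t$ are adjacent, and $0$ otherwise; $\sigma(A(\Phi))$ denotes its spectrum, i.e. the multiset of its eigenvalues, counted with multiplicity. The gain $\varphi(\overrightarrow{C})$ of a directed cycle is the product of the gains of its oriented edges, and $\Re(\varphi(C))$ denotes the real part of $\varphi(\overrightarrow{C})$ for either direction $\overrightarrow{C}$ of the cycle $C$ (the two directions have conjugate gains, so this is well defined). Let $\mathcal{D}_n$ be the collection of all connected simple graphs on $n$ vertices that have, for each $k$ with $3\le k\le n$, at most one cycle of length $k$. **Theorem.** Let $\varphi_1$ and $\varphi_2$ be two $\mathbb{T}$-gains on $G\in\mathcal{D}_n$, and let $\Phi_1=(G,\varphi_1)$,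 $\Phi_2=(G,\varphi_2)$. Then $\sigma(A(\Phi_1))=\sigma(A(\Phi_2))$ if and only if $\Re(\varphi_1(C))=\Re(\varphi_2(C))$ for all cycles $C$ in $G$. -/

import Mathlib

/-- A `𝕋`-gain on a simple graph: a unit complex number on each oriented edge, the opposite
orientation carrying the inverse. -/
structure TGain {V : Type*} (G : SimpleGraph V) where
  /-- the gain of an oriented edge -/
  gain : G.Dart → Circle
  gain_symm : ∀ d : G.Dart, gain d.symm = (gain d)⁻¹

namespace TGain

open Classical in
/-- The gain adjacency matrix `A(Φ)` of `Φ = (G, φ)`. -/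
noncomputable def adjMatrix {V : Type*} {G : SimpleGraph V} (φ : TGain G) : Matrix V V ℂ :=
  Matrix.of fun s t => if h : G.Adj s t then (φ.gain ⟨(s, t), h⟩ : ℂ) else 0

/-- The gain of a walk: the product of the gains of its oriented edges, in order. For a closed walk
that is a cycle this is the gain of the corresponding directed cycle. -/
noncomputable def walkGain {V : Type*} {G : SimpleGraph V} (φ : TGain G) {u v : V}
    (p : G.Walk u v) : Circle :=
  (p.darts.map φ.gain).prod

/-- The spectrum `σ(A(Φ))`: the eigenvalues of the gain adjacency matrix, counted with
multiplicity. -/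
noncomputable def spectrum {V : Type*} [Fintype V] [DecidableEq V] {G : SimpleGraph V}
    (φ : TGain G) : Multiset ℂ :=
  φ.adjMatrix.charpoly.roots

end TGain

/-- The (undirected) cycles of length `k` in `G`, as subgraphs of `G`. -/
def cyclesOfLength {V : Type*} (G : SimpleGraph V) (k : ℕ) : Set G.Subgraph :=
  {C | ∃ (v : V) (p : G.Walk v v), p.IsCycle ∧ p.length = k ∧ p.toSubgraph = C}

/-- `G ∈ 𝒟ₙ`: `G` is a connected graph on `n` vertices that has, for each `3 ≤ k ≤ n`, at most one
cycle of length `k`. -/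
structure MemD {V : Type*} [Fintype V] (n : ℕ) (G : SimpleGraph V) : Prop where
  connected : G.Connected
  card_eq : Fintype.card V = n
  atMostOne : ∀ k : ℕ, 3 ≤ k → k ≤ n → (cyclesOfLength G k).Subsingleton

/-! The spectrum carries the same information as det(1 - XA), whose Leibniz expansion runs over
permutations. Each term is multiplicative over disjoint cycles, and a cyclic permutation of length k
contributes -X^k times its weight, the product of the entries of A along it. A is Hermitian, so c
and c⁻¹ have conjugate weights. Their sum is 2 Re φ(C) when c runs around a graph cycle C; a
transposition along an edge has weight 1, and any other cyclic permutation has weight 0. The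
determinant depends only on these pair sums (`Equiv.Perm.sum_prod_cycleFactorsFinset_congr`), so
equal real parts give equal spectra. Conversely, induct on k. Once the pair sums agree below length
k, the coefficient of X^k determines the total weight of the k-cycles
(`Matrix.sum_permWeight_eq_of_charpolyRev_eq`). If G has only one cycle C of length k, just its two
orientations contribute, and that total is 2 Re φ(C). -/

/-! ### Sums over permutations of products over cycle factors -/

open Classical Equiv.Perm in
/-- The sum over permutations containing the cycle `c` factors through the permutations disjoint
from `c`. -/
theorem Equiv.Perm.sum_prod_cycleFactorsFinset_filter_mem {V R : Type*} [Fintype V] [DecidableEq V]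
    [CommRing R] (f : Equiv.Perm V → R) {c : Equiv.Perm V} (hc : c.IsCycle) :
    ∑ σ : Equiv.Perm V with c ∈ σ.cycleFactorsFinset, ∏ d ∈ σ.cycleFactorsFinset, f d =
      f c * ∑ τ : Equiv.Perm V with c.Disjoint τ, ∏ d ∈ τ.cycleFactorsFinset, f d := by
  rw [Finset.mul_sum]
  refine Finset.sum_nbij' (fun σ => c⁻¹ * σ) (fun τ => c * τ) ?_ ?_ ?_ ?_ ?_
  · intro σ hσ
    simp only [Finset.mem_filter, Finset.mem_univ, true_and] at hσ ⊢
    have h := disjoint_mul_inv_of_mem_cycleFactorsFinset hσ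
    have h2 : c⁻¹ * σ = σ * c⁻¹ := by
      have := h.commute.eq
      simp only [inv_mul_cancel_right] at this
      exact inv_mul_eq_of_eq_mul this
    rw [h2]
    exact h.symm
  · intro τ hτ
    simp only [Finset.mem_filter, Finset.mem_univ, true_and] at hτ ⊢
    rw [hτ.cycleFactorsFinset_mul_eq_union, hc.cycleFactorsFinset_eq_singleton]
    simp
  · intro σ _; simp
  · intro τ _; simp
  · intro σ hσ
    simp only [Finset.mem_filter, Finset.mem_univ, true_and] at hσ
    have h := disjoint_mul_inv_of_mem_cycleFactorsFinset hσ
    have h2 : c⁻¹ * σ = σ * c⁻¹ := by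
      have := h.commute.eq
      simp only [inv_mul_cancel_right] at this
      exact inv_mul_eq_of_eq_mul this
    rw [h2]
    have h3 : σ = c * (σ * c⁻¹) := by rw [← h.commute.eq, inv_mul_cancel_right]
    conv_lhs => rw [h3]
    rw [h.symm.cycleFactorsFinset_mul_eq_union,
      Finset.prod_union h.symm.disjoint_cycleFactorsFinset, hc.cycleFactorsFinset_eq_singleton,
      Finset.prod_singleton]

open Classical Equiv.Perm in
/-- Changing the weight of one cycle and of its inverse, with the same total. -/
theorem Equiv.Perm.sum_prod_cycleFactorsFinset_congr_single {V R : Type*} [Fintype V]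
    [DecidableEq V] [CommRing R] [IsDomain R] [CharZero R] (f g : Equiv.Perm V → R)
    {c : Equiv.Perm V} (hc : c.IsCycle) (h : f c + f c⁻¹ = g c + g c⁻¹)
    (hfg : ∀ d, d ≠ c → d ≠ c⁻¹ → f d = g d) :
    ∑ σ : Equiv.Perm V, ∏ d ∈ σ.cycleFactorsFinset, f d =
      ∑ σ : Equiv.Perm V, ∏ d ∈ σ.cycleFactorsFinset, g d := by
  by_cases hcc : c = c⁻¹
  · have h1 : f c = g c := by
      rw [← hcc, ← two_mul, ← two_mul] at h
      exact mul_left_cancel₀ two_ne_zero h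
    have : f = g := by
      funext d
      by_cases hd : d = c
      · rw [hd, h1]
      · exact hfg d hd (hcc ▸ hd)
    rw [this]
  -- No permutation has both `c` and `c⁻¹` as factors, since they are distinct and share their
  -- support. Splitting by which one occurs leaves the same cofactor for both.
  have key : ∀ f : Equiv.Perm V → R, ∑ σ : Equiv.Perm V, ∏ d ∈ σ.cycleFactorsFinset, f d =
      (f c + f c⁻¹) * ∑ τ : Equiv.Perm V with c.Disjoint τ, ∏ d ∈ τ.cycleFactorsFinset, f d +
      ∑ σ : Equiv.Perm V with c ∉ σ.cycleFactorsFinset ∧ c⁻¹ ∉ σ.cycleFactorsFinset,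
        ∏ d ∈ σ.cycleFactorsFinset, f d := by
    intro f
    have h2 : ∑ σ : Equiv.Perm V with c⁻¹ ∈ σ.cycleFactorsFinset,
        ∏ d ∈ σ.cycleFactorsFinset, f d =
        f c⁻¹ * ∑ τ : Equiv.Perm V with c.Disjoint τ, ∏ d ∈ τ.cycleFactorsFinset, f d := by
      rw [sum_prod_cycleFactorsFinset_filter_mem f hc.inv]
      simp only [disjoint_inv_left_iff]
    rw [add_mul, ← sum_prod_cycleFactorsFinset_filter_mem f hc, ← h2,
      ← Finset.sum_filter_add_sum_filter_not Finset.univ (fun σ => c ∈ σ.cycleFactorsFinset),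
      add_assoc]
    congr 1
    rw [← Finset.sum_filter_add_sum_filter_not (Finset.univ.filter _)
      (fun σ : Equiv.Perm V => c⁻¹ ∈ σ.cycleFactorsFinset), Finset.filter_filter,
      Finset.filter_filter]
    congr 1
    refine Finset.sum_congr ?_ fun _ _ => rfl
    ext σ
    simp only [Finset.mem_filter, Finset.mem_univ, true_and, and_iff_right_iff_imp]
    intro h1 h2
    have hd : c.Disjoint c⁻¹ := cycleFactorsFinset_pairwise_disjoint σ h2 h1 hcc
    exact hc.ne_one (Equiv.Perm.disjoint_refl_iff.1 (disjoint_inv_right_iff.1 hd))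
  rw [key f, key g, h]
  congr 1
  · congr 1
    refine Finset.sum_congr rfl fun τ hτ => Finset.prod_congr rfl fun d hd => ?_
    simp only [Finset.mem_filter, Finset.mem_univ, true_and] at hτ
    refine hfg d ?_ ?_
    · rintro rfl
      exact Finset.disjoint_left.1 hτ.disjoint_cycleFactorsFinset
        (by simp [hc.cycleFactorsFinset_eq_singleton]) hd
    · rintro rfl
      exact Finset.disjoint_left.1 (disjoint_inv_left_iff.2 hτ).disjoint_cycleFactorsFinset
        (by simp [hc.inv.cycleFactorsFinset_eq_singleton]) hd
  · refine Finset.sum_congr rfl fun τ hτ => Finset.prod_congr rfl fun d hd => ?_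
    simp only [Finset.mem_filter, Finset.mem_univ, true_and] at hτ
    exact hfg d (fun h => hτ.1 (h ▸ hd)) (fun h => hτ.2 (h ▸ hd))

/-- The sum over all permutations of the product of the weights of their cycles depends only on the
total weight of each cycle and its inverse. -/
theorem Equiv.Perm.sum_prod_cycleFactorsFinset_congr {V R : Type*} [Fintype V]
    [DecidableEq V] [CommRing R] [IsDomain R] [CharZero R] (f g : Equiv.Perm V → R)
    (h : ∀ c : Equiv.Perm V, c.IsCycle → f c + f c⁻¹ = g c + g c⁻¹) :
    ∑ σ : Equiv.Perm V, ∏ d ∈ σ.cycleFactorsFinset, f d =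
      ∑ σ : Equiv.Perm V, ∏ d ∈ σ.cycleFactorsFinset, g d := by
  -- `S` bounds, up to inversion, the cycles on which `f` and `g` may differ; they are exchanged one
  -- pair at a time.
  suffices H : ∀ (S : Finset (Equiv.Perm V)) (f g : Equiv.Perm V → R),
      (∀ c : Equiv.Perm V, c.IsCycle → f c + f c⁻¹ = g c + g c⁻¹) →
      (∀ d : Equiv.Perm V, d.IsCycle → d ∉ S → d⁻¹ ∉ S → f d = g d) →
      ∑ σ : Equiv.Perm V, ∏ d ∈ σ.cycleFactorsFinset, f d =
        ∑ σ : Equiv.Perm V, ∏ d ∈ σ.cycleFactorsFinset, g d from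
    H Finset.univ f g h fun d _ hd => absurd (Finset.mem_univ d) hd
  intro S
  induction S using Finset.induction_on with
  | empty =>
    intro f g _ hfg
    refine Finset.sum_congr rfl fun σ _ => Finset.prod_congr rfl fun d hd => ?_
    exact hfg d (Equiv.Perm.mem_cycleFactorsFinset_iff.1 hd).1 (Finset.notMem_empty _)
      (Finset.notMem_empty _)
  | insert c S _ ih =>
    intro f g h hfg
    by_cases hc : c.IsCycle
    · set g' : Equiv.Perm V → R := fun d => if d = c ∨ d = c⁻¹ then g d else f d with hg'
      have hin : ∀ d : Equiv.Perm V, (d⁻¹ = c ∨ d⁻¹ = c⁻¹) ↔ (d = c ∨ d = c⁻¹) := by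
        intro d
        rw [inv_inj, inv_eq_iff_eq_inv, or_comm]
      rw [sum_prod_cycleFactorsFinset_congr_single f g' hc (by simp [hg', h c hc])
        (fun d h1 h2 => by simp [hg', h1, h2])]
      refine ih g' g (fun d hd => ?_) (fun d hd h1 h2 => ?_)
      · simp only [hg', hin]
        split_ifs
        · rfl
        · exact h d hd
      · simp only [hg']
        split_ifs with h3
        · rfl
        · push Not at h3
          refine hfg d hd (by simp [h1, h3.1]) ?_
          rw [Finset.mem_insert, not_or, inv_eq_iff_eq_inv]
          exact ⟨h3.2, h2⟩
    · refine ih f g h fun d hd h1 h2 => hfg d hd ?_ ?_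
      · rw [Finset.mem_insert, not_or]
        exact ⟨fun e => hc (e ▸ hd), h1⟩
      · rw [Finset.mem_insert, not_or]
        exact ⟨fun e => hc (e ▸ hd.inv), h2⟩

/-- A function on permutations that is multiplicative on disjoint ones is the product of its values
on the cycle factors. -/
theorem Equiv.Perm.eq_prod_cycleFactorsFinset {V R : Type*} [Fintype V] [DecidableEq V]
    [CommMonoid R] (F : Equiv.Perm V → R) (h1 : F 1 = 1)
    (hmul : ∀ σ τ : Equiv.Perm V, σ.Disjoint τ → F (σ * τ) = F σ * F τ) (σ : Equiv.Perm V) :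
    F σ = ∏ c ∈ σ.cycleFactorsFinset, F c := by
  induction σ using Equiv.Perm.cycle_induction_on with
  | base_one => simp [h1]
  | base_cycles σ hσ => simp [hσ.cycleFactorsFinset_eq_singleton]
  | induction_disjoint σ τ hd _ hs ht =>
    rw [hmul σ τ hd, hd.cycleFactorsFinset_mul_eq_union,
      Finset.prod_union hd.disjoint_cycleFactorsFinset, hs, ht]

/-! ### The reversed characteristic polynomial and cycle weights -/

namespace Matrix

open Polynomial

variable {V R : Type*} [Fintype V] [DecidableEq V] [CommRing R]

/-- The product of the entries of `M` at the positions `(x, σ x)` with `σ x ≠ x`. -/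
def permWeight (M : Matrix V V R) (σ : Equiv.Perm V) : R :=
  ∏ x ∈ σ.support, M x (σ x)

/-- The contribution of `σ` to the reversed characteristic polynomial of a matrix with zero
diagonal. -/
noncomputable def permTerm (M : Matrix V V R) (σ : Equiv.Perm V) : R[X] :=
  ((Equiv.Perm.sign σ : ℤ) : R[X]) * ∏ x ∈ σ.support, (-(X * C (M x (σ x))))

theorem permTerm_one (M : Matrix V V R) : M.permTerm 1 = 1 := by
  simp [permTerm]

theorem permTerm_mul (M : Matrix V V R) {σ τ : Equiv.Perm V} (h : σ.Disjoint τ) :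
    M.permTerm (σ * τ) = M.permTerm σ * M.permTerm τ := by
  have e1 : ∏ x ∈ σ.support, (-(X * C (M x ((σ * τ) x)))) =
      ∏ x ∈ σ.support, (-(X * C (M x (σ x)))) := by
    refine Finset.prod_congr rfl fun x hx => ?_
    have : τ x = x := by
      by_contra hne
      exact Finset.disjoint_left.1 h.disjoint_support hx (Equiv.Perm.mem_support.2 hne)
    rw [Equiv.Perm.mul_apply, this]
  have e2 : ∏ x ∈ τ.support, (-(X * C (M x ((σ * τ) x)))) =
      ∏ x ∈ τ.support, (-(X * C (M x (τ x)))) := by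
    refine Finset.prod_congr rfl fun x hx => ?_
    have : σ x = x := by
      by_contra hne
      exact Finset.disjoint_left.1 h.disjoint_support (Equiv.Perm.mem_support.2 hne) hx
    rw [h.commute.eq, Equiv.Perm.mul_apply, this]
  rw [permTerm, h.support_mul, Finset.prod_union h.disjoint_support, e1, e2, permTerm, permTerm,
    Equiv.Perm.sign_mul]
  push_cast
  ring

theorem permTerm_eq_prod (M : Matrix V V R) (σ : Equiv.Perm V) :
    M.permTerm σ = ∏ c ∈ σ.cycleFactorsFinset, M.permTerm c :=
  Equiv.Perm.eq_prod_cycleFactorsFinset _ M.permTerm_one (fun _ _ h => M.permTerm_mul h) σ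

theorem permTerm_eq (M : Matrix V V R) (σ : Equiv.Perm V) :
    M.permTerm σ = C (((Equiv.Perm.sign σ : ℤ) : R) * (-1) ^ σ.support.card * M.permWeight σ) *
      X ^ σ.support.card := by
  simp only [permTerm, permWeight, Finset.prod_neg, Finset.prod_mul_distrib, Finset.prod_const,
    map_mul, map_prod, map_intCast, map_pow, map_neg, map_one]
  ring

theorem charpolyRev_eq_sum_permTerm (M : Matrix V V R) (hM : ∀ x, M x x = 0) :
    M.charpolyRev = ∑ σ : Equiv.Perm V, M.permTerm σ := by
  rw [charpolyRev, ← det_transpose, det_apply']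
  refine Finset.sum_congr rfl fun σ _ => ?_
  rw [permTerm]
  congr 1
  rw [← Finset.prod_subset (Finset.subset_univ σ.support)]
  · refine Finset.prod_congr rfl fun x hx => ?_
    have : x ≠ σ x := fun h => Equiv.Perm.mem_support.1 hx h.symm
    simp [one_apply_ne this]
  · intro x _ hx
    rw [Equiv.Perm.notMem_support] at hx
    simp [hx, hM]

theorem charpolyRev_eq_of_permWeight [IsDomain R] [CharZero R] {M N : Matrix V V R}
    (hM : ∀ x, M x x = 0) (hN : ∀ x, N x x = 0)
    (h : ∀ c : Equiv.Perm V, c.IsCycle →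
      M.permWeight c + M.permWeight c⁻¹ = N.permWeight c + N.permWeight c⁻¹) :
    M.charpolyRev = N.charpolyRev := by
  rw [charpolyRev_eq_sum_permTerm M hM, charpolyRev_eq_sum_permTerm N hN]
  rw [Finset.sum_congr rfl fun σ _ => M.permTerm_eq_prod σ,
    Finset.sum_congr rfl fun σ _ => N.permTerm_eq_prod σ]
  refine Equiv.Perm.sum_prod_cycleFactorsFinset_congr _ _ fun c hc => ?_
  simp only [permTerm_eq, Equiv.Perm.support_inv, Equiv.Perm.sign_inv, ← add_mul, ← map_add,
    ← mul_add, h c hc]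

-- A permutation moving k points is either a k-cycle or a product of shorter cycles. The shorter
-- ones can be given the weights of `N` without changing the sum, after which everything but the
-- k-cycles cancels in the coefficient of X^k.
open Classical in
theorem sum_permWeight_eq_of_charpolyRev_eq [IsDomain R] [CharZero R] {M N : Matrix V V R}
    (hM : ∀ x, M x x = 0) (hN : ∀ x, N x x = 0) (hMN : M.charpolyRev = N.charpolyRev) (k : ℕ)
    (h : ∀ c : Equiv.Perm V, c.IsCycle → c.support.card < k →
      M.permWeight c + M.permWeight c⁻¹ = N.permWeight c + N.permWeight c⁻¹) :
    ∑ c : Equiv.Perm V with c.IsCycle ∧ c.support.card = k, M.permWeight c =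
      ∑ c : Equiv.Perm V with c.IsCycle ∧ c.support.card = k, N.permWeight c := by
  -- Hybrid weights: those of `N` on cycles shorter than `k`, those of `M` on the rest.
  set g : Equiv.Perm V → R[X] := fun c =>
    if c.support.card < k then N.permTerm c else M.permTerm c with hg
  have hdvd : ∀ σ : Equiv.Perm V,
      X ^ σ.support.card ∣ ∏ c ∈ σ.cycleFactorsFinset, g c := by
    intro σ
    rw [Equiv.Perm.eq_prod_cycleFactorsFinset (fun σ : Equiv.Perm V => (X : R[X]) ^ σ.support.card)
      (by simp) (fun σ τ hd => by simp only [hd.card_support_mul, pow_add]) σ]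
    refine Finset.prod_dvd_prod_of_dvd _ _ fun c _ => ?_
    simp only [hg]
    split_ifs <;> exact (permTerm_eq (R := R) _ c).symm ▸ dvd_mul_left (X ^ _) (C _)
  have hsum : ∑ σ : Equiv.Perm V, ∏ c ∈ σ.cycleFactorsFinset, g c =
      ∑ σ : Equiv.Perm V, N.permTerm σ := by
    rw [← charpolyRev_eq_sum_permTerm N hN, ← hMN, charpolyRev_eq_sum_permTerm M hM]
    rw [Finset.sum_congr rfl fun σ _ => M.permTerm_eq_prod σ]
    refine Equiv.Perm.sum_prod_cycleFactorsFinset_congr _ _ fun c hc => ?_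
    simp only [hg, Equiv.Perm.support_inv]
    split_ifs with hk
    · simp only [permTerm_eq, Equiv.Perm.support_inv, Equiv.Perm.sign_inv, ← add_mul, ← map_add,
        ← mul_add, h c hc hk]
    · rfl
  have hterm : ∀ σ : Equiv.Perm V,
      (∏ c ∈ σ.cycleFactorsFinset, g c).coeff k - (N.permTerm σ).coeff k =
        if σ.IsCycle ∧ σ.support.card = k then N.permWeight σ - M.permWeight σ else 0 := by
    intro σ
    split_ifs with hσ
    · obtain ⟨hc, hk⟩ := hσ
      rw [hc.cycleFactorsFinset_eq_singleton, Finset.prod_singleton]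
      simp only [hg, hk, lt_irrefl, if_false, permTerm_eq, coeff_C_mul, coeff_X_pow, if_true,
        hc.sign]
      -- A k-cycle has sign -(-1)^k, so its coefficient is minus its weight; hence the order `N -
      -- M`.
      have : ((-1 : R) ^ k) * (-1) ^ k = 1 := by rw [← mul_pow]; simp
      push_cast
      linear_combination (N.permWeight σ - M.permWeight σ) * this
    · by_cases hk : k < σ.support.card
      · obtain ⟨q, hq⟩ := hdvd σ
        rw [hq, permTerm_eq, coeff_C_mul, coeff_X_pow, coeff_X_pow_mul', if_neg hk.not_ge,
          if_neg hk.ne]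
        simp
      · rw [sub_eq_zero, permTerm_eq_prod]
        congr 1
        refine Finset.prod_congr rfl fun c hcσ => ?_
        have hle := Finset.card_le_card (Equiv.Perm.mem_cycleFactorsFinset_support_le hcσ)
        have : c.support.card < k := by
          refine lt_of_le_of_ne (hle.trans (not_lt.1 hk)) fun hck => hσ ?_
          have hs : c.support = σ.support :=
            Finset.eq_of_subset_of_card_le (Equiv.Perm.mem_cycleFactorsFinset_support_le hcσ)
              (by omega)
          rw [Equiv.Perm.mem_cycleFactorsFinset_iff] at hcσ
          have hcs : c = σ := by
            ext x
            by_cases hx : x ∈ c.support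
            · exact hcσ.2 x hx
            · rw [Equiv.Perm.notMem_support.1 hx, Equiv.Perm.notMem_support.1 (hs ▸ hx)]
          exact ⟨hcs ▸ hcσ.1, hcs ▸ hck⟩
        simp only [hg, this, if_true]
  have h0 : ∑ σ : Equiv.Perm V, ((∏ c ∈ σ.cycleFactorsFinset, g c).coeff k -
      (N.permTerm σ).coeff k) = 0 := by
    rw [Finset.sum_sub_distrib, ← finsetSum_coeff, ← finsetSum_coeff, hsum, sub_self]
  simp_rw [hterm] at h0
  rw [← Finset.sum_filter, Finset.sum_sub_distrib, sub_eq_zero] at h0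
  exact h0.symm

/-- Both characteristic polynomials have degree `Fintype.card V`, so reversal is reflection at a
common degree, an involution. -/
theorem charpolyRev_eq_iff [Nontrivial R] {M N : Matrix V V R} :
    M.charpolyRev = N.charpolyRev ↔ M.charpoly = N.charpoly := by
  rw [← reverse_charpoly, ← reverse_charpoly]
  refine ⟨fun h => ?_, fun h => by rw [h]⟩
  rw [reverse, reverse, charpoly_natDegree_eq_dim, charpoly_natDegree_eq_dim] at h
  ext i
  have := congrArg (fun p => p.coeff (revAt (Fintype.card V) i)) h
  simpa only [coeff_reflect, revAt_invol] using this

end Matrix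

/-! ### A cyclic permutation is determined by its edges up to inversion -/

theorem Equiv.Perm.IsCycle.isCycleOn_support {V : Type*} [Fintype V] [DecidableEq V]
    {c : Equiv.Perm V} (hc : c.IsCycle) : c.IsCycleOn (c.support : Set V) := by
  convert hc.isCycleOn using 1
  ext x
  simp

/-- Once the direction agrees at one point it agrees everywhere: turning back would give `d` a
period dividing 2. -/
theorem Equiv.Perm.IsCycle.eq_or_eq_inv {V : Type*} [Fintype V] [DecidableEq V]
    {c d : Equiv.Perm V} (hc : c.IsCycle) (hd : d.IsCycle) (h3 : 3 ≤ c.support.card)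
    (h : ∀ a b, (a ∈ c.support ∧ (b = c a ∨ b = c⁻¹ a)) ↔
      (a ∈ d.support ∧ (b = d a ∨ b = d⁻¹ a))) :
    d = c ∨ d = c⁻¹ := by
  have hs : c.support = d.support := by
    ext a
    exact ⟨fun ha => ((h a (c a)).1 ⟨ha, Or.inl rfl⟩).1,
      fun ha => ((h a (d a)).2 ⟨ha, Or.inl rfl⟩).1⟩
  have main : ∀ e : Equiv.Perm V, e.IsCycle → e.support = d.support →
      (∀ a ∈ e.support, d a = e a ∨ d a = e⁻¹ a) → ∀ x ∈ e.support, d x = e x → d = e := by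
    intro e he hes hde x hx hdx
    have hx' : x ∈ d.support := hes ▸ hx
    have hpow : ∀ i : ℕ, (d ^ i) x = (e ^ i) x ∧ (d ^ (i + 1)) x = (e ^ (i + 1)) x := by
      intro i
      induction i with
      | zero => simpa using hdx
      | succ i ih =>
        refine ⟨ih.2, ?_⟩
        have hmem : (e ^ (i + 1)) x ∈ e.support := by
          rw [Equiv.Perm.pow_apply_mem_support]; exact hx
        rw [pow_succ' d, Equiv.Perm.mul_apply, ih.2]
        rcases hde _ hmem with h1 | h1
        · rw [h1, pow_succ' e (i + 1), Equiv.Perm.mul_apply]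
        · exfalso
          have h2 : d ((e ^ (i + 1)) x) = (e ^ i) x := by
            rw [h1, pow_succ' e, Equiv.Perm.mul_apply, Equiv.Perm.coe_inv, Equiv.symm_apply_apply]
          rw [← ih.2, ← ih.1, ← Equiv.Perm.mul_apply, ← pow_succ',
            hd.isCycleOn_support.pow_apply_eq_pow_apply hx'] at h2
          have h4 : 2 ≡ 0 [MOD d.support.card] := Nat.ModEq.add_left_cancel' i h2
          have := Nat.le_of_dvd (by norm_num) ((Nat.modEq_zero_iff_dvd).1 h4)
          rw [hs] at h3
          omega
    ext y
    by_cases hy : y ∈ e.support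
    · obtain ⟨i, -, rfl⟩ := he.isCycleOn_support.exists_pow_eq hx hy
      have := (hpow i).2
      rwa [pow_succ' d, pow_succ' e, Equiv.Perm.mul_apply, Equiv.Perm.mul_apply, (hpow i).1] at this
    · rw [Equiv.Perm.notMem_support.1 hy, Equiv.Perm.notMem_support.1 (hes ▸ hy)]
  have hdc : ∀ a ∈ c.support, d a = c a ∨ d a = c⁻¹ a := fun a ha =>
    ((h a (d a)).2 ⟨hs ▸ ha, Or.inl rfl⟩).2
  obtain ⟨x, hx⟩ := hc.nonempty_support
  rcases hdc x hx with h1 | h1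
  · exact Or.inl (main c hc hs hdc x hx h1)
  · refine Or.inr (main c⁻¹ hc.inv (by rw [Equiv.Perm.support_inv, hs]) (fun a ha => ?_) x
      (by rwa [Equiv.Perm.support_inv]) h1)
    rw [inv_inv]
    exact (hdc a (by rwa [Equiv.Perm.support_inv] at ha)).symm

/-! ### Graph cycles and cyclic permutations -/

namespace SimpleGraph.Walk

variable {V : Type*} {G : SimpleGraph V}

/-- The closed walk `p` runs once around the cyclic permutation `c`. -/
structure RunsAlong [Fintype V] [DecidableEq V] {v : V} (p : G.Walk v v) (c : Equiv.Perm V) :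
    Prop where
  isCycle : c.IsCycle
  mem_support : v ∈ c.support
  length_eq : p.length = c.support.card
  getVert_eq : ∀ i ≤ p.length, p.getVert i = (c ^ i) v

theorem IsCycle.exists_runsAlong [Fintype V] [DecidableEq V] {v : V} {p : G.Walk v v}
    (hp : p.IsCycle) : ∃ c : Equiv.Perm V, p.RunsAlong c := by
  -- The last vertex repeats the base point; without it the vertices are distinct.
  set l := p.support.dropLast with hl
  have hlen : l.length = p.length := by simp [hl]
  have h3 := hp.three_le_length
  have hnd : l.Nodup := hp.nodup_dropLast_support
  have hget : ∀ i (h : i < l.length), l[i] = p.getVert i := by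
    intro i h
    simp only [hl, List.getElem_dropLast]
    exact p.support_getElem_eq_getVert _
  have hstep : ∀ i < p.length, l.formPerm (p.getVert i) = p.getVert (i + 1) := by
    intro i hi
    rw [← hget i (hlen ▸ hi), List.formPerm_apply_getElem l hnd, hget]
    rcases (Nat.succ_le_of_lt hi).eq_or_lt with h | h
    · rw [hlen, show i + 1 = p.length from h]
      simp
    · rw [hlen, Nat.mod_eq_of_lt h]
  have hsupp : l.formPerm.support = l.toFinset := by
    refine List.support_formPerm_of_nodup l hnd fun x hx => ?_
    have : l.length = 1 := by rw [hx]; rfl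
    omega
  refine ⟨l.formPerm, List.isCycle_formPerm hnd (by omega), ?_, ?_, ?_⟩
  · rw [hsupp, List.mem_toFinset]
    have := List.getElem_mem (l := l) (n := 0) (by omega)
    rwa [hget, getVert_zero] at this
  · rw [hsupp, List.toFinset_card_of_nodup hnd, hlen]
  · intro i
    induction i with
    | zero => simp
    | succ i ih =>
      intro hi
      rw [← hstep i hi, ih (by omega), pow_succ', Equiv.Perm.mul_apply]

theorem exists_of_adj_succ (n : ℕ) (u : ℕ → V) (hadj : ∀ i < n, G.Adj (u i) (u (i + 1))) {a b : V}
    (ha : u 0 = a) (hb : u n = b) :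
    ∃ q : G.Walk a b, q.length = n ∧ ∀ i ≤ n, q.getVert i = u i := by
  induction n generalizing u a with
  | zero =>
    subst ha hb
    exact ⟨nil, rfl, fun i hi => by simp [Nat.le_zero.1 hi]⟩
  | succ n ih =>
    subst ha
    obtain ⟨q, hq, hv⟩ := ih (fun i => u (i + 1)) (fun i hi => hadj (i + 1) (by omega)) rfl hb
    refine ⟨cons (hadj 0 (by omega)) q, by simp [hq], fun i hi => ?_⟩
    rcases i with _ | i
    · simp
    · rw [getVert_cons_succ, hv i (by omega)]

theorem exists_isCycle_runsAlong [Fintype V] [DecidableEq V] {c : Equiv.Perm V} (hc : c.IsCycle)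
    (h3 : 3 ≤ c.support.card) (hadj : ∀ x ∈ c.support, G.Adj x (c x)) :
    ∃ (v : V) (p : G.Walk v v), p.IsCycle ∧ p.RunsAlong c := by
  obtain ⟨v, hv⟩ := hc.nonempty_support
  have hcyc := hc.isCycleOn_support
  have hinj : ∀ i j : ℕ, (c ^ i) v = (c ^ j) v ↔ i ≡ j [MOD c.support.card] := fun i j =>
    hcyc.pow_apply_eq_pow_apply hv
  -- A path from `c v` around to `v`, to be closed by the edge from `v` to `c v`.
  obtain ⟨q, hq, hqv⟩ := exists_of_adj_succ (G := G) (c.support.card - 1) (fun i => (c ^ (i + 1)) v)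
    (fun i _ => by
      have := hadj ((c ^ (i + 1)) v) (by rw [Equiv.Perm.pow_apply_mem_support]; exact hv)
      rwa [← Equiv.Perm.mul_apply, ← pow_succ'] at this) (a := c v) (b := v) (by simp)
    (by
      have : c.support.card - 1 + 1 = c.support.card := by omega
      simp only [this, hcyc.pow_card_apply hv])
  refine ⟨v, cons (hadj v hv) q, ?_, hc, hv, by rw [length_cons]; omega, ?_⟩
  · rw [cons_isCycle_iff]
    constructor
    · rw [← IsPath.getVert_injOn_iff]
      intro i hi j hj hij
      simp only [Set.mem_ofPred_eq, hq] at hi hj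
      rw [hqv i hi, hqv j hj, hinj] at hij
      have := Nat.ModEq.add_right_cancel' 1 hij
      exact Nat.ModEq.eq_of_lt_of_lt this (by omega) (by omega)
    · intro hmem
      obtain ⟨i, hil, hi⟩ := q.mk_mem_edges_iff_exists.1 hmem
      rw [hq] at hil
      rw [hqv i (by omega), hqv (i + 1) (by omega), Sym2.eq_iff] at hi
      -- If `q` used the closing edge, either `v` would recur too early or `c ^ 2` would fix `v`;
      -- the latter contradicts length at least 3.
      rcases hi with ⟨h1, -⟩ | ⟨h1, h2⟩
      · have : (c ^ (i + 1)) v = (c ^ 0) v := by simpa using h1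
        rw [hinj] at this
        have := Nat.ModEq.eq_of_lt_of_lt this (by omega) (by omega)
        omega
      · have h1' : (c ^ (i + 1)) v = (c ^ 1) v := by simpa using h1
        have h2' : (c ^ (i + 1 + 1)) v = (c ^ 0) v := by simpa using h2
        rw [hinj] at h1' h2'
        have := Nat.ModEq.eq_of_lt_of_lt h1' (by omega) (by omega)
        obtain rfl : i = 0 := by omega
        have := Nat.ModEq.eq_of_lt_of_lt h2' (by omega) (by omega)
        omega
  · intro i hi
    rcases i with _ | i
    · simp
    · rw [length_cons] at hi
      rw [getVert_cons_succ, hqv i (by omega)]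

namespace RunsAlong

variable [Fintype V] [DecidableEq V] {v : V} {p : G.Walk v v} {c : Equiv.Perm V}

theorem support_eq_image (h : p.RunsAlong c) :
    c.support = (Finset.range p.length).image p.getVert := by
  ext x
  rw [Finset.mem_image]
  constructor
  · intro hx
    obtain ⟨i, hi, rfl⟩ := h.isCycle.isCycleOn_support.exists_pow_eq h.mem_support hx
    rw [← h.length_eq] at hi
    exact ⟨i, Finset.mem_range.2 hi, h.getVert_eq i hi.le⟩
  · rintro ⟨i, hi, rfl⟩
    rw [h.getVert_eq i (Finset.mem_range.1 hi).le, Equiv.Perm.pow_apply_mem_support]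
    exact h.mem_support

theorem getVert_succ (h : p.RunsAlong c) {i : ℕ} (hi : i < p.length) :
    p.getVert (i + 1) = c (p.getVert i) := by
  rw [h.getVert_eq i hi.le, h.getVert_eq (i + 1) hi, pow_succ', Equiv.Perm.mul_apply]

theorem prod_support {R : Type*} [CommMonoid R] (h : p.RunsAlong c) (f : V → V → R) :
    ∏ x ∈ c.support, f x (c x) =
      ∏ i ∈ Finset.range p.length, f (p.getVert i) (p.getVert (i + 1)) := by
  rw [h.support_eq_image, Finset.prod_image]
  · exact Finset.prod_congr rfl fun i hi => by rw [h.getVert_succ (Finset.mem_range.1 hi)]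
  · intro i hi j hj hij
    rw [Finset.mem_coe, Finset.mem_range] at hi hj
    rw [h.getVert_eq i hi.le, h.getVert_eq j hj.le,
      h.isCycle.isCycleOn_support.pow_apply_eq_pow_apply h.mem_support, ← h.length_eq] at hij
    exact Nat.ModEq.eq_of_lt_of_lt hij hi hj

theorem toSubgraph_adj_iff (h : p.RunsAlong c) (a b : V) :
    p.toSubgraph.Adj a b ↔ a ∈ c.support ∧ (b = c a ∨ b = c⁻¹ a) := by
  have key : ∀ a b, (∃ i < p.length, p.getVert i = a ∧ p.getVert (i + 1) = b) ↔
      a ∈ c.support ∧ b = c a := by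
    intro a b
    rw [h.support_eq_image]
    simp only [Finset.mem_image, Finset.mem_range]
    constructor
    · rintro ⟨i, hi, rfl, rfl⟩
      exact ⟨⟨i, hi, rfl⟩, h.getVert_succ hi⟩
    · rintro ⟨⟨i, hi, rfl⟩, rfl⟩
      exact ⟨i, hi, rfl, h.getVert_succ hi⟩
  have hmem : ∀ a b, b = c⁻¹ a → (b ∈ c.support ↔ a ∈ c.support) := by
    rintro a b rfl
    rw [← Equiv.Perm.apply_mem_support, Equiv.Perm.coe_inv, Equiv.apply_symm_apply]
  rw [Walk.toSubgraph_adj_iff]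
  constructor
  · rintro ⟨i, he, hi⟩
    rcases Sym2.eq_iff.1 he with ⟨h1, h2⟩ | ⟨h1, h2⟩
    · obtain ⟨h3, h4⟩ := (key a b).1 ⟨i, hi, h1, h2⟩
      exact ⟨h3, Or.inl h4⟩
    · obtain ⟨h3, h4⟩ := (key b a).1 ⟨i, hi, h1, h2⟩
      have h5 : b = c⁻¹ a := by rw [h4, Equiv.Perm.coe_inv, Equiv.symm_apply_apply]
      exact ⟨(hmem a b h5).1 h3, Or.inr h5⟩
  · rintro ⟨ha, hb | hb⟩
    · obtain ⟨i, hi, h1, h2⟩ := (key a b).2 ⟨ha, hb⟩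
      exact ⟨i, by rw [h1, h2], hi⟩
    · obtain ⟨i, hi, h1, h2⟩ := (key b a).2
        ⟨(hmem a b hb).2 ha, by rw [hb, Equiv.Perm.coe_inv, Equiv.apply_symm_apply]⟩
      exact ⟨i, by rw [h1, h2, Sym2.eq_swap], hi⟩

end RunsAlong

end SimpleGraph.Walk

/-! ### Weights of the gain adjacency matrix -/

namespace TGain

variable {V : Type*} {G : SimpleGraph V} (φ : TGain G)

theorem adjMatrix_of_adj {x y : V} (h : G.Adj x y) :
    φ.adjMatrix x y = (φ.gain ⟨(x, y), h⟩ : ℂ) := by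
  simp [adjMatrix, h]

theorem adjMatrix_of_not_adj {x y : V} (h : ¬ G.Adj x y) : φ.adjMatrix x y = 0 := by
  simp [adjMatrix, h]

theorem adjMatrix_self (x : V) : φ.adjMatrix x x = 0 :=
  φ.adjMatrix_of_not_adj (G.loopless.irrefl x)

theorem star_adjMatrix (x y : V) : star (φ.adjMatrix x y) = φ.adjMatrix y x := by
  by_cases h : G.Adj x y
  · rw [φ.adjMatrix_of_adj h, φ.adjMatrix_of_adj h.symm]
    have := φ.gain_symm ⟨(x, y), h⟩
    rw [show (⟨(y, x), h.symm⟩ : G.Dart) = SimpleGraph.Dart.symm ⟨(x, y), h⟩ from rfl, this,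
      Circle.coe_inv_eq_conj]
    rfl
  · rw [φ.adjMatrix_of_not_adj h, φ.adjMatrix_of_not_adj fun h' => h h'.symm, star_zero]

theorem adjMatrix_mul_adjMatrix_of_adj {x y : V} (h : G.Adj x y) :
    φ.adjMatrix x y * φ.adjMatrix y x = 1 := by
  rw [← φ.star_adjMatrix x y, φ.adjMatrix_of_adj h, Complex.star_def, Complex.mul_conj,
    Circle.normSq_coe, Complex.ofReal_one]

theorem coe_walkGain {u v : V} (p : G.Walk u v) :
    (φ.walkGain p : ℂ) =
      ∏ i ∈ Finset.range p.length, φ.adjMatrix (p.getVert i) (p.getVert (i + 1)) := by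
  induction p with
  | nil => simp [walkGain]
  | cons h q ih =>
    rw [SimpleGraph.Walk.length_cons, Finset.prod_range_succ']
    simp only [SimpleGraph.Walk.getVert_cons_succ, SimpleGraph.Walk.getVert_zero]
    rw [← ih, φ.adjMatrix_of_adj h, mul_comm, ← Circle.coe_mul]
    simp [walkGain]

variable [Fintype V] [DecidableEq V]

theorem permWeight_inv (c : Equiv.Perm V) :
    φ.adjMatrix.permWeight c⁻¹ = star (φ.adjMatrix.permWeight c) := by
  rw [Matrix.permWeight, Matrix.permWeight, star_prod, Equiv.Perm.support_inv]
  refine Finset.prod_bij' (fun x _ => c⁻¹ x) (fun x _ => c x) ?_ ?_ ?_ ?_ ?_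
  · intro x hx
    rwa [← Equiv.Perm.apply_mem_support, Equiv.Perm.coe_inv, Equiv.apply_symm_apply]
  · intro x hx
    rwa [Equiv.Perm.apply_mem_support]
  · simp
  · simp
  · intro x _
    rw [Equiv.Perm.coe_inv, Equiv.apply_symm_apply, star_adjMatrix]

theorem permWeight_add_inv {v : V} {p : G.Walk v v} {c : Equiv.Perm V} (h : p.RunsAlong c) :
    φ.adjMatrix.permWeight c + φ.adjMatrix.permWeight c⁻¹ =
      ((2 * (φ.walkGain p : ℂ).re : ℝ) : ℂ) := by
  have hw : φ.adjMatrix.permWeight c = φ.walkGain p :=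
    (h.prod_support φ.adjMatrix).trans (φ.coe_walkGain p).symm
  rw [permWeight_inv, hw, Complex.star_def, Complex.add_conj]

theorem permWeight_eq_zero {c : Equiv.Perm V} (h : ¬ ∀ x ∈ c.support, G.Adj x (c x)) :
    φ.adjMatrix.permWeight c = 0 := by
  push Not at h
  obtain ⟨x, hx, hn⟩ := h
  exact Finset.prod_eq_zero hx (φ.adjMatrix_of_not_adj hn)

/-- Opposite orientations carry inverse gains, so transpositions do not see the gain. -/
theorem permWeight_eq_one {c : Equiv.Perm V} (h2 : c.support.card = 2)
    (h : ∀ x ∈ c.support, G.Adj x (c x)) : φ.adjMatrix.permWeight c = 1 := by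
  obtain ⟨x, y, hxy, rfl⟩ := Equiv.Perm.card_support_eq_two.1 h2
  have hadj : G.Adj x y := by simpa [hxy] using h x (by simp [Equiv.Perm.support_swap hxy])
  rw [Matrix.permWeight, Equiv.Perm.support_swap hxy, Finset.prod_pair hxy, Equiv.swap_apply_left,
    Equiv.swap_apply_right, φ.adjMatrix_mul_adjMatrix_of_adj hadj]

theorem spectrum_eq_iff (φ₁ φ₂ : TGain G) :
    φ₁.spectrum = φ₂.spectrum ↔ φ₁.adjMatrix.charpolyRev = φ₂.adjMatrix.charpolyRev := by
  rw [Matrix.charpolyRev_eq_iff]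
  refine ⟨fun h => ?_, fun h => by rw [spectrum, spectrum, h]⟩
  rw [(IsAlgClosed.splits φ₁.adjMatrix.charpoly).eq_prod_roots_of_monic
      (Matrix.charpoly_monic _),
    (IsAlgClosed.splits φ₂.adjMatrix.charpoly).eq_prod_roots_of_monic
      (Matrix.charpoly_monic _)]
  exact congrArg (fun s : Multiset ℂ => (s.map fun a => Polynomial.X - Polynomial.C a).prod) h

end TGain

/-! ### Comparing two gains -/

/-- Both directions of a cyclic permutation of fixed length contribute; in a graph with at most one
cycle of each length nothing else does. -/
theorem TGain.sum_permWeight_isCycle {V : Type*} [Fintype V] [DecidableEq V] {n : ℕ}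
    {G : SimpleGraph V} (hG : MemD n G) (φ : TGain G) {c : Equiv.Perm V} (hc : c.IsCycle)
    (h3 : 3 ≤ c.support.card) {v : V} {p : G.Walk v v} (hp : p.IsCycle) (hpc : p.RunsAlong c)
    [DecidablePred fun d : Equiv.Perm V => d.IsCycle ∧ d.support.card = c.support.card] :
    ∑ d : Equiv.Perm V with d.IsCycle ∧ d.support.card = c.support.card,
      φ.adjMatrix.permWeight d = φ.adjMatrix.permWeight c + φ.adjMatrix.permWeight c⁻¹ := by
  have hne : c ≠ c⁻¹ := by
    intro h
    obtain ⟨x, hx⟩ := hc.nonempty_support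
    have h2 : (c ^ 2) x = x := by
      rw [pow_two, Equiv.Perm.mul_apply]
      nth_rewrite 1 [h]
      rw [Equiv.Perm.coe_inv, Equiv.symm_apply_apply]
    rw [hc.isCycleOn_support.pow_apply_eq hx] at h2
    have := Nat.le_of_dvd (by norm_num) h2
    omega
  rw [← Finset.sum_pair hne]
  symm
  refine Finset.sum_subset ?_ ?_
  · intro d hd
    rw [Finset.mem_insert, Finset.mem_singleton] at hd
    rw [Finset.mem_filter]
    rcases hd with rfl | rfl
    · exact ⟨Finset.mem_univ _, hc, rfl⟩
    · exact ⟨Finset.mem_univ _, hc.inv, by rw [Equiv.Perm.support_inv]⟩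
  · intro d hd hdn
    rw [Finset.mem_filter] at hd
    obtain ⟨-, hd, hcard⟩ := hd
    -- A nonzero weight would make `d` trace a graph cycle of the same length, hence the same
    -- subgraph as `p`, forcing `d` to be `c` or `c⁻¹`.
    refine φ.permWeight_eq_zero fun hadj => hdn ?_
    obtain ⟨w, q, hq, hqd⟩ := SimpleGraph.Walk.exists_isCycle_runsAlong hd (by omega) hadj
    have hsub : q.toSubgraph = p.toSubgraph :=
      hG.atMostOne c.support.card h3 (hG.card_eq ▸ Finset.card_le_univ _)
        ⟨w, q, hq, hqd.length_eq.trans hcard, rfl⟩ ⟨v, p, hp, hpc.length_eq, rfl⟩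
    rw [Finset.mem_insert, Finset.mem_singleton]
    refine hc.eq_or_eq_inv hd h3 fun a b => ?_
    rw [← hpc.toSubgraph_adj_iff, ← hqd.toSubgraph_adj_iff, hsub]

theorem TGain.permWeight_add_inv_eq {V : Type*} [Fintype V] [DecidableEq V] {G : SimpleGraph V}
    (φ₁ φ₂ : TGain G) {c : Equiv.Perm V} (hc : c.IsCycle)
    (h : ∀ (v : V) (C : G.Walk v v), C.IsCycle → C.length = c.support.card →
      (φ₁.walkGain C : ℂ).re = (φ₂.walkGain C : ℂ).re) :
    φ₁.adjMatrix.permWeight c + φ₁.adjMatrix.permWeight c⁻¹ =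
      φ₂.adjMatrix.permWeight c + φ₂.adjMatrix.permWeight c⁻¹ := by
  by_cases hadj : ∀ x ∈ c.support, G.Adj x (c x)
  · rcases hc.two_le_card_support.eq_or_lt with h2 | h3
    · simp only [TGain.permWeight_inv, TGain.permWeight_eq_one _ h2.symm hadj]
    · obtain ⟨v, p, hp, hpc⟩ := SimpleGraph.Walk.exists_isCycle_runsAlong hc h3 hadj
      rw [φ₁.permWeight_add_inv hpc, φ₂.permWeight_add_inv hpc, h v p hp hpc.length_eq]
  · simp only [TGain.permWeight_inv, TGain.permWeight_eq_zero _ hadj]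

theorem mainTheorem7 {V : Type*} [Fintype V] [DecidableEq V] (n : ℕ) (G : SimpleGraph V)
    (hG : MemD n G) (φ₁ φ₂ : TGain G) :
    φ₁.spectrum = φ₂.spectrum ↔
      ∀ (v : V) (C : G.Walk v v), C.IsCycle →
        (φ₁.walkGain C : ℂ).re = (φ₂.walkGain C : ℂ).re := by
  classical
  rw [TGain.spectrum_eq_iff]
  constructor
  · intro h
    suffices H : ∀ (k : ℕ) (v : V) (C : G.Walk v v), C.IsCycle → C.length = k →
        (φ₁.walkGain C : ℂ).re = (φ₂.walkGain C : ℂ).re from fun v C hC => H _ v C hC rfl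
    intro k
    -- The coefficient at length `k` isolates the k-cycles only when all shorter cycles already
    -- agree.
    induction k using Nat.strong_induction_on with
    | _ k ih =>
      intro v C hC hk
      obtain ⟨c, hcc⟩ := hC.exists_runsAlong
      have h3 : 3 ≤ c.support.card := hcc.length_eq ▸ hC.three_le_length
      have hsum := Matrix.sum_permWeight_eq_of_charpolyRev_eq φ₁.adjMatrix_self φ₂.adjMatrix_self h
        c.support.card (fun d hd hlt => ?_)
      · rw [φ₁.sum_permWeight_isCycle hG hcc.isCycle h3 hC hcc,
          φ₂.sum_permWeight_isCycle hG hcc.isCycle h3 hC hcc, φ₁.permWeight_add_inv hcc,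
          φ₂.permWeight_add_inv hcc] at hsum
        have := Complex.ofReal_injective hsum
        linarith
      · exact TGain.permWeight_add_inv_eq φ₁ φ₂ hd fun v C hC hl =>
          ih _ (by rw [hl, ← hk, hcc.length_eq]; exact hlt) v C hC rfl
  · intro h
    exact Matrix.charpolyRev_eq_of_permWeight φ₁.adjMatrix_self φ₂.adjMatrix_self fun c hc =>
      TGain.permWeight_add_inv_eq φ₁ φ₂ hc fun v C hC _ => h v C hC
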